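/- Corollary (PFS representation of $\zeta(2,a)$). Let $a\in\mathbb{C}$ with $\Re(a)<2$ and $a\notin\{0,-\tfrac12,-1,-\tfrac32,\dots\}$, and let $\zeta(m,a)=\sum_{k=0}^{\infty}\frac{1}{(a+k)^m}$ denote the Hurwitz zeta function for integers $m\ge 2$. Then $$\zeta(2,a)=\sum_{k=0}^{\infty}\frac{1}{(a+k)^2}=\sum_{k=0}^{\infty}\frac{2(-1)^k\,\Gamma(2a+k)}{\Gamma(a)^2\,k!\,(a+k)^3},$$ where the first series converges absolutely and the second converges (in general only conditionally) as the limit of its partial sums $\sum_{k=0}^{N-1}$, $N\to\infty$. -/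

import Mathlib

/-- The Hurwitz zeta function `ζ(m, a) = ∑_{k ≥ 0} 1 / (a + k) ^ m` at an integer first argument
`m ≥ 2` and a complex parameter `a` that is not a non-positive integer. (Mathlib's `hurwitzZeta`
takes its parameter on the real unit circle only.) -/
noncomputable def hurwitzZetaNat (m : ℕ) (a : ℂ) : ℂ :=
  ∑' k : ℕ, 1 / (a + k) ^ m

/-! For real `0 < a ≤ 1/2`, evaluate the second difference of `B(a + z, a - z)` at `z = 0` in two
ways. Folding the beta integral onto `(0, 1)` and expanding `(1 + x)^(-2a)` gives the alternating
series. A telescoping sum for `∏ (1 - z² / (a + j)²)`, whose limit is `Γ(a)² / (Γ(a + z) Γ(a - z))`,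
gives `∑ 1 / (a + k)²`. Dividing by `z²` and letting `z → 0` yields the identity
(`tsum_pochCoeff_div_cube`).

The terms of the alternating series have size `k^(2 Re a - 4)`, so it converges locally uniformly
around a vertical strip, and the identity theorem extends the formula there (`hasSum_alternating`).

The remaining `a` are reached by shifts `a ↦ a + 1`. Partial sums at `a` and `a + 1` differ by a
companion series over `a²`, so the formula propagates once the companion series sums to `1`. Where
`a` and `a + 1` both lie in the strip, this follows from `ζ(2, a) - ζ(2, a + 1) = 1 / a²`. The
companion series has its own shift rule, with a boundary term that vanishes for `Re a < 0`, which
carries the value `1` to all `Re a < 1`. -/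

/-- The rising factorial divided by a factorial, `(s)ₖ / k! = s (s + 1) ⋯ (s + k - 1) / k!`. -/
noncomputable def pochCoeff {K : Type*} [Field K] (s : K) (k : ℕ) : K :=
  (∏ j ∈ Finset.range k, (s + j)) / (k.factorial : K)

@[simp]
theorem pochCoeff_zero {K : Type*} [Field K] (s : K) : pochCoeff s 0 = 1 := by
  simp [pochCoeff]

theorem ofReal_pochCoeff (s : ℝ) (k : ℕ) : ((pochCoeff s k : ℝ) : ℂ) = pochCoeff (s : ℂ) k := by
  simp [pochCoeff]

theorem pochCoeff_nonneg {s : ℝ} (hs : 0 ≤ s) (k : ℕ) : 0 ≤ pochCoeff s k := by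
  unfold pochCoeff
  positivity

theorem pochCoeff_le_one {s : ℝ} (hs : 0 ≤ s) (hs' : s ≤ 1) (k : ℕ) : pochCoeff s k ≤ 1 := by
  unfold pochCoeff
  rw [div_le_one (by positivity), ← Finset.prod_range_add_one_eq_factorial]
  push_cast
  refine Finset.prod_le_prod (fun _ _ => by positivity) fun j _ => by linarith

/-- Raising both the real part and the imaginary part of the parameter (in absolute value)
increases the norm of the coefficients. -/
theorem norm_pochCoeff_le {s : ℂ} {x y : ℝ} (hx : |s.re| ≤ x) (hy : |s.im| ≤ y) (k : ℕ) :
    ‖pochCoeff s k‖ ≤ ‖pochCoeff (⟨x, y⟩ : ℂ) k‖ := by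
  unfold pochCoeff
  rw [norm_div, norm_div, norm_prod, norm_prod]
  gcongr with j _
  rw [Complex.norm_eq_sqrt_sq_add_sq, Complex.norm_eq_sqrt_sq_add_sq]
  have hj : (0 : ℝ) ≤ j := Nat.cast_nonneg j
  refine Real.sqrt_le_sqrt (add_le_add (sq_le_sq' ?_ ?_) ?_)
  · simp only [Complex.add_re, Complex.natCast_re]
    linarith [neg_abs_le s.re]
  · simp only [Complex.add_re, Complex.natCast_re]
    linarith [le_abs_self s.re]
  · simp only [Complex.add_im, Complex.natCast_im, add_zero]
    exact sq_le_sq' (by linarith [neg_abs_le s.im]) (by linarith [le_abs_self s.im])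

theorem Gamma_add_natCast {s : ℂ} (hs : ∀ m : ℕ, s ≠ -m) (k : ℕ) :
    Complex.Gamma (s + k) = Complex.Gamma s * (k.factorial : ℂ) * pochCoeff s k := by
  unfold pochCoeff
  rw [mul_assoc, mul_div_cancel₀ _ (Nat.cast_ne_zero.2 k.factorial_ne_zero)]
  induction k with
  | zero => simp
  | succ k ih =>
    have h : s + k ≠ 0 := fun h => hs k (eq_neg_of_add_eq_zero_left h)
    rw [Finset.prod_range_succ, ← mul_assoc, ← ih, Nat.cast_succ, ← add_assoc,
      Complex.Gamma_add_one _ h, mul_comm]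

/-- Euler's limit for `Γ`: `GammaSeq s n` times `pochCoeff s n * (s + n)` is exactly `n^s`, and
`GammaSeq s n` stays away from `0` because its limit `Γ(s)` is nonzero. -/
theorem pochCoeff_isBigO {s : ℂ} (hs : ∀ m : ℕ, s ≠ -m) :
    (fun k : ℕ => pochCoeff s k) =O[Filter.atTop] fun k : ℕ => (k : ℝ) ^ (s.re - 1) := by
  have hG : 0 < ‖Complex.Gamma s‖ := norm_pos_iff.2 (Complex.Gamma_ne_zero hs)
  have h1 : ∀ᶠ n : ℕ in Filter.atTop, ‖Complex.Gamma s‖ / 2 < ‖Complex.GammaSeq s n‖ :=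
    (Complex.GammaSeq_tendsto_Gamma s).norm.eventually_const_lt (half_lt_self hG)
  refine Asymptotics.IsBigO.of_bound (4 / ‖Complex.Gamma s‖) ?_
  obtain ⟨N, hN⟩ := exists_nat_gt (2 * ‖s‖)
  filter_upwards [h1, Filter.eventually_ge_atTop N, Filter.eventually_gt_atTop 0] with n hn hnN hn0
  have hnpos : (0 : ℝ) < n := Nat.cast_pos.2 hn0
  have hns : (n : ℝ) / 2 ≤ ‖s + n‖ := by
    have h2 : ‖(n : ℂ)‖ - ‖s‖ ≤ ‖s + n‖ := by
      have := norm_sub_norm_le (n : ℂ) (-s)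
      rwa [norm_neg, sub_neg_eq_add, add_comm (n : ℂ)] at this
    rw [Complex.norm_natCast] at h2
    have : (N : ℝ) ≤ n := Nat.cast_le.2 hnN
    linarith
  have hfac : (0 : ℝ) < n.factorial := Nat.cast_pos.2 n.factorial_pos
  have hne : ∏ j ∈ Finset.range (n + 1), (s + j) ≠ 0 :=
    Finset.prod_ne_zero_iff.2 fun j _ h => hs j (eq_neg_of_add_eq_zero_left h)
  have key : ‖Complex.GammaSeq s n‖ * (‖pochCoeff s n‖ * ‖s + n‖) = (n : ℝ) ^ s.re := by
    rw [← norm_mul, ← norm_mul, ← Complex.norm_natCast_cpow_of_pos hn0]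
    congr 1
    unfold Complex.GammaSeq pochCoeff
    rw [Finset.prod_range_succ] at hne ⊢
    have := left_ne_zero_of_mul hne
    have := right_ne_zero_of_mul hne
    have : (n.factorial : ℂ) ≠ 0 := Nat.cast_ne_zero.2 n.factorial_ne_zero
    field_simp
  have h3 : ‖Complex.Gamma s‖ / 2 * (‖pochCoeff s n‖ * (n / 2)) ≤ (n : ℝ) ^ s.re := by
    rw [← key]
    gcongr
  rw [Real.rpow_sub_one hnpos.ne', Real.norm_of_nonneg (by positivity), div_mul_div_comm,
    le_div_iff₀ (by positivity)]
  linarith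

/-! ### Binomial series and beta integrals on the unit interval -/

/-- The binomial series for a negative exponent. -/
theorem hasSum_pochCoeff_mul_pow (s : ℝ) {x : ℝ} (hx : |x| < 1) :
    HasSum (fun k : ℕ => (-1) ^ k * pochCoeff s k * x ^ k) ((1 + x) ^ (-s)) := by
  have hc : ∀ k : ℕ, Ring.choose (-(s : ℂ)) k = (-1) ^ k * pochCoeff (s : ℂ) k := by
    intro k
    rw [Ring.choose_eq_smul, pochCoeff, smul_eq_mul, ← mul_div_assoc, div_eq_inv_mul]
    congr 1
    induction k with
    | zero => simp
    | succ k ih =>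
      rw [descPochhammer_succ_right, Polynomial.smeval_mul, ih, Finset.prod_range_succ]
      simp only [Polynomial.smeval_sub, Polynomial.smeval_X, Polynomial.smeval_natCast, pow_one,
        pow_zero, nsmul_eq_mul, mul_one]
      ring
  have h := (Complex.one_add_cpow_hasFPowerSeriesOnBall_zero (a := -(s : ℂ))).hasSum
    (y := (x : ℂ)) (by
      rw [← ENNReal.ofReal_one, Metric.eball_ofReal]
      simpa using hx)
  simp only [binomialSeries_apply, hc, List.ofFn_const, List.prod_replicate, smul_eq_mul,
    zero_add] at h
  rw [← Complex.hasSum_ofReal, Complex.ofReal_cpow (by linarith [neg_abs_le x])]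
  push_cast [ofReal_pochCoeff]
  exact h

theorem setIntegral_add_sub_two_mul {f g h : ℝ → ℝ} {s : Set ℝ}
    (hf : MeasureTheory.IntegrableOn f s) (hg : MeasureTheory.IntegrableOn g s)
    (hh : MeasureTheory.IntegrableOn h s) :
    ∫ x in s, (f x + g x - 2 * h x) =
      (∫ x in s, f x) + (∫ x in s, g x) - 2 * ∫ x in s, h x := by
  rw [← MeasureTheory.integral_const_mul, ← MeasureTheory.integral_add hf hg]
  exact MeasureTheory.integral_sub (hf.add hg) (hh.const_mul 2)

theorem intervalIntegrable_rpow_mul_one_sub_rpow {p q : ℝ} (hp : 0 < p) (hq : 0 < q) :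
    IntervalIntegrable (fun u : ℝ => u ^ (p - 1) * (1 - u) ^ (q - 1)) MeasureTheory.volume 0 1 := by
  have h := Complex.betaIntegral_convergent (u := p) (v := q) (by simpa) (by simpa)
  rw [intervalIntegrable_iff, Set.uIoc_of_le zero_le_one] at h ⊢
  refine MeasureTheory.IntegrableOn.congr_fun (MeasureTheory.Integrable.re h) (fun x hx => ?_) measurableSet_Ioc
  have h1 : 0 ≤ 1 - x := by linarith [hx.2]
  simp only [RCLike.re_to_complex]
  rw [← Complex.ofReal_one, ← Complex.ofReal_sub, ← Complex.ofReal_sub, ← Complex.ofReal_sub,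
    ← Complex.ofReal_cpow hx.1.le, ← Complex.ofReal_cpow h1, ← Complex.ofReal_mul,
    Complex.ofReal_re]

theorem integral_rpow_mul_one_sub_rpow {p q : ℝ} (hp : 0 < p) (hq : 0 < q) :
    ∫ u in (0 : ℝ)..1, u ^ (p - 1) * (1 - u) ^ (q - 1) =
      Real.Gamma p * Real.Gamma q / Real.Gamma (p + q) := by
  have h := Complex.betaIntegral_eq_Gamma_mul_div p q (by simpa) (by simpa)
  rw [← Complex.ofReal_add, Complex.Gamma_ofReal, Complex.Gamma_ofReal, Complex.Gamma_ofReal] at h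
  apply Complex.ofReal_injective
  push_cast
  rw [← h, Complex.betaIntegral, ← intervalIntegral.integral_ofReal]
  refine intervalIntegral.integral_congr fun x hx => ?_
  rw [Set.uIcc_of_le zero_le_one] at hx
  have h1 : 0 ≤ 1 - x := by linarith [hx.2]
  rw [Complex.ofReal_mul, Complex.ofReal_cpow hx.1, Complex.ofReal_cpow h1]
  push_cast
  rfl

theorem integrableOn_rpow_Ioo {p : ℝ} (hp : 0 < p) :
    MeasureTheory.IntegrableOn (fun x : ℝ => x ^ (p - 1)) (Set.Ioo 0 1) := by
  rw [← intervalIntegrable_iff_integrableOn_Ioo_of_le zero_le_one]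
  exact intervalIntegral.intervalIntegrable_rpow' (by linarith)

theorem integral_rpow_Ioo {p : ℝ} (hp : 0 < p) :
    ∫ x in Set.Ioo (0 : ℝ) 1, x ^ (p - 1) = 1 / p := by
  rw [← MeasureTheory.integral_Ioc_eq_integral_Ioo,
    ← intervalIntegral.integral_of_le zero_le_one, integral_rpow (Or.inl (by linarith))]
  simp [hp.ne']

theorem integrableOn_rpow_mul_one_add_rpow {p s : ℝ} (hp : 0 < p) (hs : 0 ≤ s) :
    MeasureTheory.IntegrableOn (fun x : ℝ => x ^ (p - 1) * (1 + x) ^ (-s)) (Set.Ioo 0 1) := by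
  refine (integrableOn_rpow_Ioo hp).mono' (by fun_prop) ?_
  refine (MeasureTheory.ae_restrict_iff' measurableSet_Ioo).2 (Filter.Eventually.of_forall ?_)
  intro x hx
  have h0 := hx.1
  rw [Real.norm_of_nonneg (by positivity)]
  exact mul_le_of_le_one_right (by positivity)
    (Real.rpow_le_one_of_one_le_of_nonpos (by linarith) (by linarith))

/-- The beta integral, transported to a sum of two integrals over the unit interval by
`u = x / (1 + x)` and `u = 1 / (1 + x)`. -/
theorem integral_rpow_mul_one_add_rpow_add {p q : ℝ} (hp : 0 < p) (hq : 0 < q) :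
    (∫ x in Set.Ioo (0 : ℝ) 1, x ^ (p - 1) * (1 + x) ^ (-(p + q))) +
      ∫ x in Set.Ioo (0 : ℝ) 1, x ^ (q - 1) * (1 + x) ^ (-(p + q)) =
      Real.Gamma p * Real.Gamma q / Real.Gamma (p + q) := by
  have hint := intervalIntegrable_rpow_mul_one_sub_rpow hp hq
  have hmem : (1 / 2 : ℝ) ∈ Set.uIcc (0 : ℝ) 1 := by
    rw [Set.uIcc_of_le zero_le_one]
    constructor <;> norm_num
  rw [← integral_rpow_mul_one_sub_rpow hp hq,
    ← intervalIntegral.integral_add_adjacent_intervals (b := 1 / 2)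
      (hint.mono_set (Set.uIcc_subset_uIcc_left hmem))
      (hint.mono_set (Set.uIcc_subset_uIcc_right hmem)),
    intervalIntegral.integral_of_le (by norm_num), intervalIntegral.integral_of_le (by norm_num),
    MeasureTheory.integral_Ioc_eq_integral_Ioo, MeasureTheory.integral_Ioc_eq_integral_Ioo]
  have him1 : (fun x : ℝ => x / (1 + x)) '' Set.Ioo 0 1 = Set.Ioo 0 (1 / 2) := by
    ext u
    constructor
    · rintro ⟨x, ⟨h0, h1⟩, rfl⟩
      exact ⟨by positivity, by simp only; rw [div_lt_div_iff₀ (by linarith) (by norm_num)]; linarith⟩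
    · rintro ⟨h0, h1⟩
      have h2 : 0 < 1 - u := by linarith
      refine ⟨u / (1 - u), ⟨by positivity, by rw [div_lt_one h2]; linarith⟩, ?_⟩
      have : 1 + u / (1 - u) ≠ 0 := by positivity
      field_simp
      ring
  have him2 : (fun x : ℝ => 1 / (1 + x)) '' Set.Ioo 0 1 = Set.Ioo (1 / 2) 1 := by
    ext u
    constructor
    · rintro ⟨x, ⟨h0, h1⟩, rfl⟩
      constructor
      · simp only
        rw [div_lt_div_iff₀ (by norm_num) (by linarith)]
        linarith
      · simp only
        rw [div_lt_one (by linarith)]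
        linarith
    · rintro ⟨h0, h1⟩
      have h2 : 0 < u := by linarith
      refine ⟨(1 - u) / u, ⟨div_pos (by linarith) h2, by rw [div_lt_one h2]; linarith⟩, ?_⟩
      have : 1 + (1 - u) / u ≠ 0 := by
        have : 0 < (1 - u) / u := div_pos (by linarith) h2
        linarith
      field_simp
      ring
  have hd1 : ∀ x ∈ Set.Ioo (0 : ℝ) 1,
      HasDerivWithinAt (fun x : ℝ => x / (1 + x)) (1 / (1 + x) ^ 2) (Set.Ioo 0 1) x := by
    intro x hx
    have hx0 : 1 + x ≠ 0 := by linarith [hx.1]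
    have h := ((hasDerivAt_id' x).div ((hasDerivAt_id' x).const_add 1) hx0).hasDerivWithinAt
      (s := Set.Ioo 0 1)
    rw [show 1 * (1 + x) - x * 1 = (1 : ℝ) by ring] at h
    exact h
  have hd2 : ∀ x ∈ Set.Ioo (0 : ℝ) 1,
      HasDerivWithinAt (fun x : ℝ => 1 / (1 + x)) (-(1 / (1 + x) ^ 2)) (Set.Ioo 0 1) x := by
    intro x hx
    have hx0 : 1 + x ≠ 0 := by linarith [hx.1]
    have h := ((hasDerivAt_const x (1 : ℝ)).div ((hasDerivAt_id' x).const_add 1)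
      hx0).hasDerivWithinAt (s := Set.Ioo 0 1)
    rw [show (0 * (1 + x) - 1 * 1) / (1 + x) ^ 2 = -(1 / (1 + x) ^ 2) by ring] at h
    exact h
  have hi1 : Set.InjOn (fun x : ℝ => x / (1 + x)) (Set.Ioo 0 1) := by
    intro x hx y hy hxy
    have hx0 : 1 + x ≠ 0 := by linarith [hx.1]
    have hy0 : 1 + y ≠ 0 := by linarith [hy.1]
    change _ / _ = _ / _ at hxy
    rw [div_eq_div_iff hx0 hy0] at hxy
    linarith
  have hi2 : Set.InjOn (fun x : ℝ => 1 / (1 + x)) (Set.Ioo 0 1) := by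
    intro x hx y hy hxy
    have hx0 : 1 + x ≠ 0 := by linarith [hx.1]
    have hy0 : 1 + y ≠ 0 := by linarith [hy.1]
    change _ / _ = _ / _ at hxy
    rw [div_eq_div_iff hx0 hy0] at hxy
    linarith
  -- Splits off the Jacobian `1 / (1 + x)²` common to both substitutions.
  have hpow : ∀ x : ℝ, 0 < x → (1 + x) ^ (-(p + q)) =
      1 / (1 + x) ^ 2 * (1 / ((1 + x) ^ (p - 1) * (1 + x) ^ (q - 1))) := by
    intro x hx
    have h1 : 0 < 1 + x := by linarith
    rw [Real.rpow_neg h1.le, ← Real.rpow_add h1, ← Real.rpow_natCast, div_mul_div_comm,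
      ← Real.rpow_add h1, one_mul, one_div]
    congr 2
    push_cast
    ring
  rw [← him1, ← him2,
    MeasureTheory.integral_image_eq_integral_abs_deriv_smul measurableSet_Ioo hd1 hi1,
    MeasureTheory.integral_image_eq_integral_abs_deriv_smul measurableSet_Ioo hd2 hi2]
  congr 1
  · refine MeasureTheory.setIntegral_congr_fun measurableSet_Ioo fun x hx => ?_
    have h0 := hx.1
    have h1 : 0 < 1 + x := by linarith
    have h2 : 1 - x / (1 + x) = 1 / (1 + x) := by field_simp; ring
    simp only [smul_eq_mul]
    rw [h2, abs_of_pos (by positivity), Real.div_rpow h0.le h1.le, Real.div_rpow zero_le_one h1.le,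
      Real.one_rpow, hpow x h0]
    field_simp
  · refine MeasureTheory.setIntegral_congr_fun measurableSet_Ioo fun x hx => ?_
    have h0 := hx.1
    have h1 : 0 < 1 + x := by linarith
    have h2 : 1 - 1 / (1 + x) = x / (1 + x) := by field_simp; ring
    simp only [smul_eq_mul]
    rw [h2, abs_neg, abs_of_pos (by positivity), Real.div_rpow h0.le h1.le,
      Real.div_rpow zero_le_one h1.le, Real.one_rpow, hpow x h0]
    field_simp

/-! ### The identity for real `0 < a ≤ 1/2` -/

/-- The second difference quotient of the beta function along `p + q = 2 a`, as a series. -/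
theorem hasSum_second_difference_beta {a z : ℝ} (hz : 0 < z) (hza : z < a) (ha : a ≤ 1 / 2) :
    HasSum (fun k : ℕ => (-1) ^ k * pochCoeff (2 * a) k *
        (2 * z ^ 2 / ((a + k) * ((a + k) ^ 2 - z ^ 2))))
      ((Real.Gamma (a + z) * Real.Gamma (a - z) - Real.Gamma a ^ 2) / Real.Gamma (2 * a)) := by
  have ha0 : 0 < a := by linarith
  have hp : 0 < a + z := by linarith
  have hq : 0 < a - z := by linarith
  set w : ℝ → ℝ := fun x => x ^ (a + z - 1) + x ^ (a - z - 1) - 2 * x ^ (a - 1) with hw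
  -- By AM-GM: `w x = x^(a-1) (x^z - 1)² / x^z`. Positivity makes the integrals of `x^k * w x` their
  -- own `L¹` norms.
  have hw0 : ∀ x ∈ Set.Ioo (0 : ℝ) 1, 0 ≤ w x := by
    intro x hx
    have h0 := hx.1
    have e1 : x ^ (a + z - 1) = x ^ (a - 1) * x ^ z := by
      rw [← Real.rpow_add h0]; ring_nf
    have e2 : x ^ (a - z - 1) = x ^ (a - 1) * (x ^ z)⁻¹ := by
      rw [← Real.rpow_neg h0.le, ← Real.rpow_add h0]; ring_nf
    have hy : 0 < x ^ z := by positivity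
    have e3 : w x = x ^ (a - 1) * ((x ^ z - 1) ^ 2 / x ^ z) := by
      rw [hw]
      simp only
      rw [e1, e2]
      field_simp
      ring
    rw [e3]
    positivity
  have hpw : ∀ (k : ℕ) (x : ℝ), x ∈ Set.Ioo (0 : ℝ) 1 → x ^ k * w x =
      x ^ (a + k + z - 1) + x ^ (a + k - z - 1) - 2 * x ^ (a + k - 1) := by
    intro k x hx
    have h0 := hx.1
    rw [hw]
    simp only
    rw [← Real.rpow_natCast, mul_sub, mul_add, mul_left_comm, ← Real.rpow_add h0,
      ← Real.rpow_add h0, ← Real.rpow_add h0]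
    ring_nf
  have hkp : ∀ k : ℕ, 0 < a + k - z := fun k => by
    have : (0 : ℝ) ≤ k := Nat.cast_nonneg k
    linarith
  have hki : ∀ k : ℕ, MeasureTheory.IntegrableOn (fun x => x ^ k * w x) (Set.Ioo 0 1) := by
    intro k
    have := hkp k
    refine MeasureTheory.IntegrableOn.congr_fun ?_ (fun x hx => (hpw k x hx).symm)
      measurableSet_Ioo
    exact ((integrableOn_rpow_Ioo (by linarith)).add (integrableOn_rpow_Ioo (by linarith))).sub
      ((integrableOn_rpow_Ioo (by linarith)).const_mul 2)
  have hkv : ∀ k : ℕ, ∫ x in Set.Ioo (0 : ℝ) 1, x ^ k * w x =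
      2 * z ^ 2 / ((a + k) * ((a + k) ^ 2 - z ^ 2)) := by
    intro k
    have h1 := hkp k
    have h2 : 0 < a + k + z := by linarith
    have h3 : 0 < a + k := by linarith
    have h4 : (a + k) ^ 2 - z ^ 2 ≠ 0 := by
      rw [sq_sub_sq]
      positivity
    rw [MeasureTheory.setIntegral_congr_fun measurableSet_Ioo (hpw k),
      setIntegral_add_sub_two_mul (integrableOn_rpow_Ioo h2) (integrableOn_rpow_Ioo h1)
        (integrableOn_rpow_Ioo h3), integral_rpow_Ioo h1, integral_rpow_Ioo h2,
      integral_rpow_Ioo h3, eq_div_iff (by positivity), sq_sub_sq]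
    field_simp
    ring
  have hsum : Summable fun k : ℕ => 2 * z ^ 2 / ((a + k) * ((a + k) ^ 2 - z ^ 2)) := by
    rw [← summable_nat_add_iff 1]
    have hb : Summable fun k : ℕ => 2 * z ^ 2 / (((k + 1 : ℕ) : ℝ) ^ 2 * (a + z)) :=
      (((Real.summable_nat_pow_inv.2 one_lt_two).comp_injective
        (add_left_injective 1)).mul_left (2 * z ^ 2 / (a + z))).congr fun k => by
          simp only [Function.comp]
          field_simp
    refine Summable.of_nonneg_of_le (fun k => ?_) (fun k => ?_) hb
    · rw [← hkv]
      exact MeasureTheory.setIntegral_nonneg measurableSet_Ioo fun x hx =>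
        mul_nonneg (pow_nonneg hx.1.le _) (hw0 x hx)
    · have hk : (0 : ℝ) ≤ k := Nat.cast_nonneg k
      push_cast
      rw [sq_sub_sq]
      gcongr 2 * z ^ 2 / ?_
      rw [pow_two, mul_assoc]
      have e1 : (k : ℝ) + 1 ≤ a + (k + 1) := by linarith
      have e2 : (k : ℝ) + 1 ≤ a + (k + 1) + z := by linarith
      have e3 : a + z ≤ a + (k + 1) - z := by linarith
      calc ((k : ℝ) + 1) * ((k + 1) * (a + z))
          ≤ (a + (k + 1)) * ((a + (k + 1) + z) * (a + (k + 1) - z)) := by gcongr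
        _ = _ := rfl
  -- Since `0 ≤ 2a ≤ 1`, the coefficients lie in `[0, 1]`, so the summable moments `hkv` dominate
  -- and sum and integral may be exchanged.
  have hF := MeasureTheory.hasSum_integral_of_summable_integral_norm
    (μ := MeasureTheory.volume.restrict (Set.Ioo (0 : ℝ) 1))
    (F := fun k x => ((-1) ^ k * pochCoeff (2 * a) k) * (x ^ k * w x))
    (fun k => (hki k).const_mul _) (by
      refine Summable.of_nonneg_of_le (fun k => by positivity) (fun k => ?_) hsum
      rw [← hkv]
      refine MeasureTheory.setIntegral_mono_on ((hki k).const_mul _).norm (hki k)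
        measurableSet_Ioo fun x hx => ?_
      have h0 : 0 ≤ x ^ k * w x := mul_nonneg (pow_nonneg hx.1.le _) (hw0 x hx)
      rw [norm_mul, norm_mul, norm_pow, norm_neg, norm_one, one_pow, one_mul,
        Real.norm_of_nonneg h0, Real.norm_of_nonneg (pochCoeff_nonneg (by linarith) k)]
      exact mul_le_of_le_one_left h0 (pochCoeff_le_one (by linarith) (by linarith) k))
  have hI : ∫ x in Set.Ioo (0 : ℝ) 1,
      (∑' k : ℕ, ((-1) ^ k * pochCoeff (2 * a) k) * (x ^ k * w x)) =
      (Real.Gamma (a + z) * Real.Gamma (a - z) - Real.Gamma a ^ 2) / Real.Gamma (2 * a) := by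
    have e : ∀ x ∈ Set.Ioo (0 : ℝ) 1,
        (∑' k : ℕ, ((-1) ^ k * pochCoeff (2 * a) k) * (x ^ k * w x)) =
        x ^ (a + z - 1) * (1 + x) ^ (-(2 * a)) + x ^ (a - z - 1) * (1 + x) ^ (-(2 * a)) -
        2 * (x ^ (a - 1) * (1 + x) ^ (-(2 * a))) := by
      intro x hx
      have h := (hasSum_pochCoeff_mul_pow (2 * a) (x := x)
        (abs_lt.2 ⟨by linarith [hx.1], hx.2⟩)).mul_right (w x)
      simp only [mul_assoc] at h ⊢
      rw [h.tsum_eq, hw]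
      ring
    have i1 := integrableOn_rpow_mul_one_add_rpow (s := 2 * a) hp (by linarith)
    have i2 := integrableOn_rpow_mul_one_add_rpow (s := 2 * a) hq (by linarith)
    have i3 := integrableOn_rpow_mul_one_add_rpow (s := 2 * a) ha0 (by linarith)
    rw [MeasureTheory.setIntegral_congr_fun measurableSet_Ioo e,
      setIntegral_add_sub_two_mul i1 i2 i3]
    have b1 := integral_rpow_mul_one_add_rpow_add hp hq
    have b2 := integral_rpow_mul_one_add_rpow_add ha0 ha0
    rw [show a + z + (a - z) = 2 * a by ring] at b1
    rw [← two_mul a] at b2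
    rw [b1, two_mul (∫ _ in _, _), b2]
    ring
  rw [hI] at hF
  simpa only [MeasureTheory.integral_const_mul, hkv] using hF

theorem summable_one_div_add_nat_sq {a : ℝ} (ha : 0 < a) :
    Summable fun k : ℕ => 1 / (a + k) ^ 2 := by
  rw [← summable_nat_add_iff 1]
  refine Summable.of_nonneg_of_le (fun k => by positivity) (fun k => ?_)
    ((Real.summable_nat_pow_inv.2 one_lt_two).comp_injective (add_left_injective 1))
  simp only [Function.comp]
  rw [← one_div]
  gcongr
  linarith

/-- Expansion of the product `∏ (1 - z ^ 2 / (a + j) ^ 2)`, evaluated by the Gamma function. -/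
theorem hasSum_mul_prod_one_sub {a z : ℝ} (hz : 0 < z) (hza : z < a) :
    HasSum (fun k : ℕ => 1 / (a + k) ^ 2 * ∏ j ∈ Finset.range k, (1 - z ^ 2 / (a + j) ^ 2))
      ((1 - Real.Gamma a ^ 2 / (Real.Gamma (a + z) * Real.Gamma (a - z))) / z ^ 2) := by
  have ha0 : 0 < a := hz.trans hza
  have hp : 0 < a + z := by linarith
  have hq : 0 < a - z := by linarith
  have hfac : ∀ j : ℕ, 0 ≤ 1 - z ^ 2 / (a + j) ^ 2 := fun j => by
    rw [sub_nonneg, div_le_one (by positivity)]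
    have : (0 : ℝ) ≤ j := Nat.cast_nonneg j
    gcongr
    linarith
  have hfac' : ∀ j : ℕ, 1 - z ^ 2 / (a + j) ^ 2 ≤ 1 := fun j => by
    rw [sub_le_self_iff]
    positivity
  have hlim : Filter.Tendsto (fun n : ℕ => ∏ j ∈ Finset.range n, (1 - z ^ 2 / (a + j) ^ 2))
      Filter.atTop (nhds (Real.Gamma a ^ 2 / (Real.Gamma (a + z) * Real.Gamma (a - z)))) := by
    -- `GammaSeq` at `n` has the `n + 1` factors `j ≤ n`; the powers of `n` and the factorials
    -- cancel in the quotient.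
    rw [← Filter.tendsto_add_atTop_iff_nat 1]
    have h1 := ((Real.GammaSeq_tendsto_Gamma a).pow 2).div
      ((Real.GammaSeq_tendsto_Gamma (a + z)).mul (Real.GammaSeq_tendsto_Gamma (a - z)))
      (mul_pos (Real.Gamma_pos_of_pos hp) (Real.Gamma_pos_of_pos hq)).ne'
    refine h1.congr' ?_
    filter_upwards [Filter.eventually_gt_atTop 0] with n hn
    have hn0 : (0 : ℝ) < n := Nat.cast_pos.2 hn
    have hf : (0 : ℝ) < n.factorial := Nat.cast_pos.2 n.factorial_pos
    have e : ∏ j ∈ Finset.range (n + 1), (1 - z ^ 2 / (a + j) ^ 2) =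
        (∏ j ∈ Finset.range (n + 1), (a + z + j)) * (∏ j ∈ Finset.range (n + 1), (a - z + j)) /
        (∏ j ∈ Finset.range (n + 1), (a + j)) ^ 2 := by
      rw [← Finset.prod_mul_distrib, ← Finset.prod_pow, ← Finset.prod_div_distrib]
      refine Finset.prod_congr rfl fun j _ => ?_
      have : a + j ≠ 0 := by positivity
      field_simp
      ring
    have g1 : 0 < ∏ j ∈ Finset.range (n + 1), (a + z + j) :=
      Finset.prod_pos fun j _ => by positivity
    have g2 : 0 < ∏ j ∈ Finset.range (n + 1), (a - z + j) :=
      Finset.prod_pos fun j _ => by positivity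
    have g3 : 0 < ∏ j ∈ Finset.range (n + 1), (a + j) :=
      Finset.prod_pos fun j _ => by positivity
    have e2 : (n : ℝ) ^ (a + z) * (n : ℝ) ^ (a - z) = ((n : ℝ) ^ a) ^ 2 := by
      rw [pow_two, ← Real.rpow_add hn0, ← Real.rpow_add hn0]
      ring_nf
    have e3 : 0 < (n : ℝ) ^ a := by positivity
    simp only [Pi.div_apply]
    rw [e]
    unfold Real.GammaSeq
    rw [div_mul_div_comm, mul_mul_mul_comm, e2]
    field_simp
  -- Telescoping: each summand is the drop from one partial product to the next, divided by `z²`.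
  have hpart : ∀ n : ℕ, ∑ k ∈ Finset.range n,
      1 / (a + k) ^ 2 * ∏ j ∈ Finset.range k, (1 - z ^ 2 / (a + j) ^ 2) =
      (1 - ∏ j ∈ Finset.range n, (1 - z ^ 2 / (a + j) ^ 2)) / z ^ 2 := by
    intro n
    induction n with
    | zero => simp
    | succ n ih =>
      rw [Finset.sum_range_succ, ih, Finset.prod_range_succ]
      have : a + n ≠ 0 := by positivity
      field_simp
      ring
  have hs : Summable fun k : ℕ =>
      1 / (a + k) ^ 2 * ∏ j ∈ Finset.range k, (1 - z ^ 2 / (a + j) ^ 2) :=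
    Summable.of_nonneg_of_le
      (fun k => mul_nonneg (by positivity) (Finset.prod_nonneg fun j _ => hfac j))
      (fun k => mul_le_of_le_one_right (by positivity)
        (Finset.prod_le_one (fun j _ => hfac j) fun j _ => hfac' j))
      (summable_one_div_add_nat_sq ha0)
  rw [hs.hasSum_iff_tendsto_nat]
  simp only [hpart]
  exact (hlim.const_sub 1).div_const _

/-- Both expansions express `(Γ(a + z) Γ(a - z) - Γ(a)²) / (z² Γ(2a))`. Dominated convergence lets
`z → 0⁺` inside each sum. -/
theorem tsum_pochCoeff_div_cube {a : ℝ} (ha : 0 < a) (ha' : a ≤ 1 / 2) :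
    ∑' k : ℕ, (-1) ^ k * pochCoeff (2 * a) k * (2 / (a + k) ^ 3) =
      Real.Gamma a ^ 2 / Real.Gamma (2 * a) * ∑' k : ℕ, 1 / (a + k) ^ 2 := by
  have hsmall : ∀ᶠ z : ℝ in nhdsWithin 0 (Set.Ioi 0), 0 < z ∧ z < a / 2 :=
    Ioo_mem_nhdsGT (by linarith)
  have hle : nhdsWithin (0 : ℝ) (Set.Ioi 0) ≤ nhds 0 := nhdsWithin_le_nhds
  have hfac : ∀ z : ℝ, 0 < z → z < a → ∀ j : ℕ, 0 ≤ 1 - z ^ 2 / (a + j) ^ 2 := fun z hz hza j => by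
    rw [sub_nonneg, div_le_one (by positivity)]
    have : (0 : ℝ) ≤ j := Nat.cast_nonneg j
    gcongr
    linarith
  have hfac' : ∀ (z : ℝ) (j : ℕ), 1 - z ^ 2 / (a + j) ^ 2 ≤ 1 := fun z j => by
    rw [sub_le_self_iff]
    positivity
  have hP : Filter.Tendsto (fun z : ℝ => ∑' k : ℕ,
      1 / (a + k) ^ 2 * ∏ j ∈ Finset.range k, (1 - z ^ 2 / (a + j) ^ 2))
      (nhdsWithin 0 (Set.Ioi 0)) (nhds (∑' k : ℕ, 1 / (a + k) ^ 2)) := by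
    refine tendsto_tsum_of_dominated_convergence (summable_one_div_add_nat_sq ha) (fun k => ?_) ?_
    · have hc : Continuous fun z : ℝ =>
          1 / (a + k) ^ 2 * ∏ j ∈ Finset.range k, (1 - z ^ 2 / (a + j) ^ 2) := by fun_prop
      have := (hc.tendsto 0).mono_left hle
      simpa using this
    · filter_upwards [hsmall] with z hz k
      have h0 := hfac z hz.1 (by linarith [hz.2])
      rw [Real.norm_of_nonneg (mul_nonneg (by positivity) (Finset.prod_nonneg fun j _ => h0 j))]
      exact mul_le_of_le_one_right (by positivity)
        (Finset.prod_le_one (fun j _ => h0 j) fun j _ => hfac' z j)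
  have hQ : Filter.Tendsto (fun z : ℝ => ∑' k : ℕ,
      (-1) ^ k * pochCoeff (2 * a) k * (2 / ((a + k) * ((a + k) ^ 2 - z ^ 2))))
      (nhdsWithin 0 (Set.Ioi 0))
      (nhds (∑' k : ℕ, (-1) ^ k * pochCoeff (2 * a) k * (2 / (a + k) ^ 3))) := by
    refine tendsto_tsum_of_dominated_convergence
      ((summable_one_div_add_nat_sq ha).mul_left (4 / a)) (fun k => ?_) ?_
    · have hne : (a + k) * ((a + k) ^ 2 - (0 : ℝ) ^ 2) ≠ 0 := by
        rw [zero_pow two_ne_zero, sub_zero]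
        positivity
      have hc : ContinuousAt (fun z : ℝ => (-1) ^ k * pochCoeff (2 * a) k *
          (2 / ((a + k) * ((a + k) ^ 2 - z ^ 2)))) 0 :=
        continuousAt_const.mul (continuousAt_const.div (by fun_prop) hne)
      have := hc.tendsto.mono_left hle
      rwa [zero_pow two_ne_zero, sub_zero, ← pow_succ'] at this
    · filter_upwards [hsmall] with z hz k
      have hk : (0 : ℝ) ≤ k := Nat.cast_nonneg k
      have h1 : (a + k) ^ 2 / 2 ≤ (a + k) ^ 2 - z ^ 2 := by
        have : z ^ 2 ≤ ((a + k) / 2) ^ 2 := by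
          have := hz.1
          gcongr
          linarith [hz.2]
        nlinarith [sq_nonneg (a + k)]
      have h2 : 0 < (a + k) ^ 2 - z ^ 2 := lt_of_lt_of_le (by positivity) h1
      rw [norm_mul, norm_mul, norm_pow, norm_neg, norm_one, one_pow, one_mul,
        Real.norm_of_nonneg (pochCoeff_nonneg (by linarith) k), Real.norm_of_nonneg (by positivity)]
      calc pochCoeff (2 * a) k * (2 / ((a + k) * ((a + k) ^ 2 - z ^ 2)))
          ≤ 1 * (2 / (a * ((a + k) ^ 2 / 2))) := by
            gcongr
            · exact pochCoeff_le_one (by linarith) (by linarith) k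
            · linarith
        _ = 4 / a * (1 / (a + k) ^ 2) := by
            field_simp
            norm_num
  have hΓ : Filter.Tendsto (fun z : ℝ => Real.Gamma (a + z) * Real.Gamma (a - z))
      (nhdsWithin 0 (Set.Ioi 0)) (nhds (Real.Gamma a ^ 2)) := by
    have hd : ContinuousAt Real.Gamma a := (Real.differentiableAt_Gamma fun m => by
      have : (0 : ℝ) ≤ m := Nat.cast_nonneg m
      linarith).continuousAt
    have h1 : Filter.Tendsto (fun z : ℝ => a + z) (nhds 0) (nhds a) := by
      simpa using (continuous_const_add a).tendsto 0
    have h2 : Filter.Tendsto (fun z : ℝ => a - z) (nhds 0) (nhds a) := by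
      simpa using (continuous_sub_left a).tendsto 0
    rw [pow_two]
    exact ((hd.tendsto.comp h1).mul (hd.tendsto.comp h2)).mono_left hle
  refine tendsto_nhds_unique hQ (((hΓ.div_const _).mul hP).congr' ?_)
  filter_upwards [hsmall] with z hz
  have hza : z < a := by linarith [hz.2]
  have hz0 : z ≠ 0 := hz.1.ne'
  have h1 := (hasSum_second_difference_beta hz.1 hza ha').mul_left (1 / z ^ 2)
  have h2 := hasSum_mul_prod_one_sub hz.1 hza
  have hp := Real.Gamma_pos_of_pos (show 0 < a + z by linarith [hz.1])
  have hq := Real.Gamma_pos_of_pos (show 0 < a - z by linarith)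
  rw [h2.tsum_eq]
  have h3 : ∀ k : ℕ, 1 / z ^ 2 * ((-1) ^ k * pochCoeff (2 * a) k *
      (2 * z ^ 2 / ((a + k) * ((a + k) ^ 2 - z ^ 2)))) =
      (-1) ^ k * pochCoeff (2 * a) k * (2 / ((a + k) * ((a + k) ^ 2 - z ^ 2))) := fun k => by
    field_simp
  simp only [h3] at h1
  rw [h1.tsum_eq]
  field_simp

/-! ### Analytic continuation to a vertical strip -/

theorem summable_one_div_complex_add_nat_sq (a : ℂ) :
    Summable fun k : ℕ => 1 / (a + k) ^ 2 := by
  refine Summable.of_norm_bounded_eventually_nat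
    ((Real.summable_nat_pow_inv.2 one_lt_two).mul_left 4) ?_
  obtain ⟨N, hN⟩ := exists_nat_gt (2 * ‖a‖)
  filter_upwards [Filter.eventually_ge_atTop N, Filter.eventually_gt_atTop 0] with n hnN hn0
  have hnpos : (0 : ℝ) < n := Nat.cast_pos.2 hn0
  have hns : (n : ℝ) / 2 ≤ ‖a + n‖ := by
    have h2 := norm_sub_norm_le (n : ℂ) (-a)
    rw [norm_neg, sub_neg_eq_add, add_comm (n : ℂ), Complex.norm_natCast] at h2
    have : (N : ℝ) ≤ n := Nat.cast_le.2 hnN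
    linarith
  rw [norm_div, norm_one, norm_pow]
  calc 1 / ‖a + n‖ ^ 2 ≤ 1 / ((n : ℝ) / 2) ^ 2 := by gcongr
    _ = 4 * ((n : ℝ) ^ 2)⁻¹ := by field_simp; norm_num

theorem norm_add_succ_ge {a : ℂ} (ha : -(7 / 8) < a.re) (k : ℕ) :
    ((k + 1 : ℕ) : ℝ) / 8 ≤ ‖a + (k + 1 : ℕ)‖ := by
  refine le_trans ?_ (Complex.re_le_norm _)
  simp only [Complex.add_re, Complex.natCast_re]
  push_cast
  have : (0 : ℝ) ≤ k := Nat.cast_nonneg k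
  linarith

theorem add_succ_ne_zero {a : ℂ} (ha : -(7 / 8) < a.re) (k : ℕ) : a + (k + 1 : ℕ) ≠ 0 := by
  rw [← norm_pos_iff]
  exact lt_of_lt_of_le (by positivity) (norm_add_succ_ge ha k)

/-- A bounded open rectangle that contains a vertical strip of width greater than two. -/
def stripBox (M : ℝ) : Set ℂ := Set.Ioo (-(7 / 8)) (5 / 4) ×ℂ Set.Ioo (-M) M

theorem isOpen_stripBox (M : ℝ) : IsOpen (stripBox M) := isOpen_Ioo.reProdIm isOpen_Ioo

theorem isPreconnected_stripBox (M : ℝ) : IsPreconnected (stripBox M) :=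
  (((convex_Ioo (-(7 / 8) : ℝ) (5 / 4)).linear_preimage Complex.reLm).inter
    ((convex_Ioo (-M) M).linear_preimage Complex.imLm)).isPreconnected

/-- A bound, uniform on `stripBox M`, for the terms of the alternating series. -/
noncomputable def stripBound (M : ℝ) (k : ℕ) : ℝ :=
  ‖pochCoeff (⟨5 / 2, 2 * M⟩ : ℂ) (k + 1)‖ / (((k + 1 : ℕ) : ℝ) / 8) ^ 3

theorem summable_stripBound (M : ℝ) : Summable (stripBound M) := by
  have h : Summable fun k : ℕ => ‖pochCoeff (⟨5 / 2, 2 * M⟩ : ℂ) k‖ / ((k : ℝ) / 8) ^ 3 := by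
    -- The exponent is `(5/2 - 1) - 3`, where `5/2` bounds `|Re (2a)|` on the box.
    refine summable_of_isBigO_nat (Real.summable_nat_rpow.2 (show (-(3 / 2) : ℝ) < -1 by norm_num)) ?_
    have h1 := (pochCoeff_isBigO (s := ⟨5 / 2, 2 * M⟩) fun m h => by
      have := congrArg Complex.re h
      simp only [Complex.neg_re, Complex.natCast_re] at this
      have : (0 : ℝ) ≤ m := Nat.cast_nonneg m
      linarith).norm_left
    have h2 := h1.mul (Asymptotics.isBigO_refl (fun k : ℕ => (((k : ℝ) / 8) ^ 3)⁻¹) Filter.atTop)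
    simp only [← div_eq_mul_inv] at h2
    -- `512 = 8³`.
    refine h2.trans (Asymptotics.IsBigO.of_bound 512 ?_)
    filter_upwards [Filter.eventually_gt_atTop 0] with k hk
    have hk0 : (0 : ℝ) < k := Nat.cast_pos.2 hk
    rw [Real.norm_of_nonneg (by positivity), Real.norm_of_nonneg (by positivity),
      div_pow, div_div_eq_mul_div, ← Real.rpow_natCast (k : ℝ) 3, mul_div_right_comm,
      ← Real.rpow_sub hk0]
    norm_num [mul_comm]
  exact (summable_nat_add_iff 1).2 h

theorem norm_term_le_stripBound {M : ℝ} {a : ℂ} (ha : a ∈ stripBox M) (k : ℕ) :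
    ‖(-1) ^ (k + 1) * pochCoeff (2 * a) (k + 1) / (a + (k + 1 : ℕ)) ^ 3‖ ≤ stripBound M k := by
  obtain ⟨⟨h1, h2⟩, h3, h4⟩ := ha
  rw [norm_div, norm_mul, norm_pow, norm_neg, norm_one, one_pow, one_mul, norm_pow]
  unfold stripBound
  gcongr
  · refine norm_pochCoeff_le ?_ ?_ _
    · simp only [Complex.mul_re, Complex.re_ofNat, Complex.im_ofNat, zero_mul, sub_zero]
      rw [abs_le]
      constructor <;> linarith
    · simp only [Complex.mul_im, Complex.re_ofNat, Complex.im_ofNat, zero_mul, add_zero]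
      rw [abs_le]
      constructor <;> linarith
  · exact norm_add_succ_ge h1 k

theorem summable_alternating {M : ℝ} {a : ℂ} (ha : a ∈ stripBox M) :
    Summable fun k : ℕ => (-1) ^ k * pochCoeff (2 * a) k / (a + k) ^ 3 :=
  (summable_nat_add_iff 1).1
    (Summable.of_norm_bounded (summable_stripBound M) fun k => norm_term_le_stripBound ha k)

/-- Away from `0` this function is `a³` times the full series. Splitting off the term `k = 0`
removes the pole at `0`, so the identity theorem applies on the whole box. -/
theorem differentiableOn_alternating (M : ℝ) :
    DifferentiableOn ℂ (fun a : ℂ => 1 + a ^ 3 * ∑' k : ℕ,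
      (-1) ^ (k + 1) * pochCoeff (2 * a) (k + 1) / (a + (k + 1 : ℕ)) ^ 3) (stripBox M) := by
  have h : DifferentiableOn ℂ (fun a : ℂ => ∑' k : ℕ,
      (-1) ^ (k + 1) * pochCoeff (2 * a) (k + 1) / (a + (k + 1 : ℕ)) ^ 3) (stripBox M) := by
    refine Complex.differentiableOn_tsum_of_summable_norm (summable_stripBound M) (fun k => ?_)
      (isOpen_stripBox M) fun k a ha => norm_term_le_stripBound ha k
    unfold pochCoeff
    refine DifferentiableOn.div (by fun_prop) (by fun_prop) fun a ha => ?_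
    exact pow_ne_zero _ (add_succ_ne_zero ha.1.1 k)
  fun_prop

/-- The other side times `a³`, regularised at `0` by the functional equation of `Γ`. The reciprocal
of `Γ(2a + 1)` is entire: at a pole the default `Γ = 0` gives inverse `0`, the correct value. -/
theorem differentiableOn_Gamma_mul_zeta (M : ℝ) :
    DifferentiableOn ℂ (fun a : ℂ => Complex.Gamma (a + 1) ^ 2 * (Complex.Gamma (2 * a + 1))⁻¹ *
      (1 + a ^ 2 * ∑' k : ℕ, 1 / (a + (k + 1 : ℕ)) ^ 2)) (stripBox M) := by
  have h : DifferentiableOn ℂ (fun a : ℂ => ∑' k : ℕ, 1 / (a + (k + 1 : ℕ)) ^ 2) (stripBox M) := by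
    refine Complex.differentiableOn_tsum_of_summable_norm
      (u := fun k => 1 / (((k + 1 : ℕ) : ℝ) / 8) ^ 2) ?_ (fun k => ?_)
      (isOpen_stripBox M) fun k a ha => ?_
    · have := (((Real.summable_nat_pow_inv.2 one_lt_two).comp_injective
        (add_left_injective 1)).mul_left 64)
      refine this.congr fun k => ?_
      simp only [Function.comp]
      field_simp
      norm_num
    · refine DifferentiableOn.div (by fun_prop) (by fun_prop) fun a ha => ?_
      exact pow_ne_zero _ (add_succ_ne_zero ha.1.1 k)
    · rw [norm_div, norm_one, norm_pow]
      have := norm_add_succ_ge ha.1.1 k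
      gcongr
  have h1 : DifferentiableOn ℂ (fun a : ℂ => Complex.Gamma (a + 1)) (stripBox M) := by
    intro a ha
    refine DifferentiableAt.differentiableWithinAt ?_
    refine (Complex.differentiableAt_Gamma (a + 1) fun m h => ?_).comp a (by fun_prop)
    have h0 := congrArg Complex.re h
    simp only [Complex.add_re, Complex.one_re, Complex.neg_re, Complex.natCast_re] at h0
    have : (0 : ℝ) ≤ m := Nat.cast_nonneg m
    have : -(7 / 8) < a.re := ha.1.1
    linarith
  have h2 : Differentiable ℂ (fun a : ℂ => (Complex.Gamma (2 * a + 1))⁻¹) :=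
    Complex.differentiable_one_div_Gamma.comp (by fun_prop)
  have h3 := h2.differentiableOn (s := stripBox M)
  fun_prop

theorem alternating_eq_cube_mul {M : ℝ} {a : ℂ} (ha : a ∈ stripBox M) (ha0 : a ≠ 0) :
    1 + a ^ 3 * ∑' k : ℕ, (-1) ^ (k + 1) * pochCoeff (2 * a) (k + 1) / (a + (k + 1 : ℕ)) ^ 3 =
      a ^ 3 * ∑' k : ℕ, (-1) ^ k * pochCoeff (2 * a) k / (a + k) ^ 3 := by
  rw [(summable_alternating ha).tsum_eq_zero_add]
  simp only [pow_zero, pochCoeff_zero, Nat.cast_zero, add_zero, mul_one]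
  field_simp

theorem Gamma_mul_zeta_eq_cube_mul {a : ℂ} (ha0 : a ≠ 0) :
    Complex.Gamma (a + 1) ^ 2 * (Complex.Gamma (2 * a + 1))⁻¹ *
      (1 + a ^ 2 * ∑' k : ℕ, 1 / (a + (k + 1 : ℕ)) ^ 2) =
      a ^ 3 * (Complex.Gamma a ^ 2 / (2 * Complex.Gamma (2 * a)) * ∑' k : ℕ, 1 / (a + k) ^ 2) := by
  rw [(summable_one_div_complex_add_nat_sq a).tsum_eq_zero_add, Complex.Gamma_add_one _ ha0,
    Complex.Gamma_add_one _ (mul_ne_zero two_ne_zero ha0), mul_inv, Nat.cast_zero, add_zero,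
    div_eq_mul_inv (Complex.Gamma a ^ 2), mul_inv]
  field_simp

theorem tsum_alternating_ofReal {r : ℝ} (h0 : 0 < r) (h1 : r < 1 / 2) :
    ∑' k : ℕ, (-1) ^ k * pochCoeff (2 * (r : ℂ)) k / ((r : ℂ) + k) ^ 3 =
      Complex.Gamma r ^ 2 / (2 * Complex.Gamma (2 * r)) * ∑' k : ℕ, 1 / ((r : ℂ) + k) ^ 2 := by
  have h := congrArg (fun x : ℝ => (x : ℂ) / 2) (tsum_pochCoeff_div_cube h0 h1.le)
  push_cast [Complex.ofReal_tsum, ofReal_pochCoeff, ← Complex.Gamma_ofReal] at h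
  rw [← tsum_div_const] at h
  rw [mul_comm (2 : ℂ) (Complex.Gamma _), ← div_div, div_mul_eq_mul_div, ← h]
  refine tsum_congr fun k => ?_
  ring

theorem hasSum_alternating {a : ℂ} (ha1 : -(7 / 8) < a.re) (ha2 : a.re < 5 / 4) (ha0 : a ≠ 0) :
    HasSum (fun k : ℕ => (-1) ^ k * pochCoeff (2 * a) k / (a + k) ^ 3)
      (Complex.Gamma a ^ 2 / (2 * Complex.Gamma (2 * a)) * ∑' k : ℕ, 1 / (a + k) ^ 2) := by
  set M : ℝ := |a.im| + 1 with hM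
  have hM0 : 0 < M := by positivity
  have hmem : a ∈ stripBox M :=
    ⟨⟨ha1, ha2⟩, by constructor <;> linarith [neg_abs_le a.im, le_abs_self a.im]⟩
  have hreal : ∀ r : ℝ, 0 < r → r < 1 / 2 → (r : ℂ) ∈ stripBox M := fun r h0 h1 =>
    ⟨by constructor <;> simp only [Complex.ofReal_re] <;> linarith,
      by constructor <;> simp only [Complex.ofReal_im] <;> linarith⟩
  -- The two sides agree on the real segment `(0, 1/2)`, which accumulates at `1/4`.
  have heq := AnalyticOnNhd.eqOn_of_preconnected_of_frequently_eq
    ((differentiableOn_alternating M).analyticOnNhd (isOpen_stripBox M))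
    ((differentiableOn_Gamma_mul_zeta M).analyticOnNhd (isOpen_stripBox M))
    (isPreconnected_stripBox M) (hreal (1 / 4) (by norm_num) (by norm_num)) (by
      have ht : Filter.Tendsto (fun r : ℝ => (r : ℂ)) (nhdsWithin (1 / 4) {1 / 4}ᶜ)
          (nhdsWithin ((1 / 4 : ℝ) : ℂ) {((1 / 4 : ℝ) : ℂ)}ᶜ) :=
        Complex.continuous_ofReal.continuousWithinAt.tendsto_nhdsWithin fun x hx h =>
          hx (Complex.ofReal_injective h)
      refine ht.frequently (Filter.Eventually.frequently ?_)
      filter_upwards [nhdsWithin_le_nhds (Ioo_mem_nhds (show (0 : ℝ) < 1 / 4 by norm_num)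
        (show (1 / 4 : ℝ) < 1 / 2 by norm_num))] with r hr
      have hr0 : (r : ℂ) ≠ 0 := Complex.ofReal_ne_zero.2 hr.1.ne'
      rw [alternating_eq_cube_mul (hreal r hr.1 hr.2) hr0, Gamma_mul_zeta_eq_cube_mul hr0,
        tsum_alternating_ofReal hr.1 hr.2]) hmem
  simp only at heq
  rw [alternating_eq_cube_mul hmem ha0, Gamma_mul_zeta_eq_cube_mul ha0] at heq
  rw [← mul_left_cancel₀ (pow_ne_zero 3 ha0) heq]
  exact (summable_alternating hmem).hasSum

/-! ### Recurrences under the shift `a ↦ a + 1` -/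

/-- The terms of the alternating series for `ζ(2, a)`. -/
noncomputable def pfsTerm (a : ℂ) (k : ℕ) : ℂ :=
  2 * (-1 : ℂ) ^ k * Complex.Gamma (2 * a + k) /
    (Complex.Gamma a ^ 2 * (Nat.factorial k : ℂ) * (a + (k : ℂ)) ^ 3)

/-- The terms of the companion series, whose sum is `1`. -/
noncomputable def unitTerm (a : ℂ) (k : ℕ) : ℂ :=
  2 * (-1 : ℂ) ^ k * Complex.Gamma (2 * a + k) /
    (Complex.Gamma a ^ 2 * (Nat.factorial k : ℂ) * (a + (k : ℂ)))

/-- The boundary terms in the recurrence for the companion series. -/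
noncomputable def boundaryTerm (a : ℂ) (k : ℕ) : ℂ :=
  (-1 : ℂ) ^ k * Complex.Gamma (2 * a + 1 + k) /
    (a ^ 2 * Complex.Gamma a ^ 2 * (Nat.factorial k : ℂ))

theorem two_mul_ne_neg_natCast {a : ℂ} (h : ∀ n : ℕ, a ≠ -(n : ℂ) / 2)
    (m : ℕ) : 2 * a ≠ -m := fun h' => h m (by rw [← h']; ring)

theorem ne_neg_natCast {a : ℂ} (h : ∀ n : ℕ, a ≠ -(n : ℂ) / 2)
    (m : ℕ) : a ≠ -m := fun h' => h (2 * m) (by rw [h']; push_cast; ring)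

theorem add_natCast_ne_zero {a : ℂ} (h : ∀ n : ℕ, a ≠ -(n : ℂ) / 2) (m : ℕ) : a + m ≠ 0 := fun h' =>
  ne_neg_natCast h m (eq_neg_of_add_eq_zero_left h')

theorem ne_zero_of_ne_neg_half {a : ℂ} (h : ∀ n : ℕ, a ≠ -(n : ℂ) / 2)
    : a ≠ 0 := fun h' => h 0 (by simp [h'])

theorem add_one_ne_neg_half {a : ℂ} (h : ∀ n : ℕ, a ≠ -(n : ℂ) / 2)
    (n : ℕ) : a + 1 ≠ -(n : ℂ) / 2 := fun h' =>
  h (n + 2) (by rw [eq_sub_of_add_eq h']; push_cast; ring)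

theorem Gamma_two_mul_add_one_add {a : ℂ} (h : ∀ n : ℕ, a ≠ -(n : ℂ) / 2)
    (k : ℕ) : Complex.Gamma (2 * (a + 1) + k) =
    (2 * a + (k + 1 : ℕ)) * Complex.Gamma (2 * a + (k + 1 : ℕ)) := by
  rw [← Complex.Gamma_add_one]
  · congr 1
    push_cast
    ring
  · exact fun h' => two_mul_ne_neg_natCast h (k + 1) (eq_neg_of_add_eq_zero_left h')

/-- With `n = k + 1`, the shift multiplies the `n`-th term by `-n (2a + n) / a²`, and `n (2a + n) =
(a + n)² - a²`. -/
theorem pfsTerm_add_one {a : ℂ} (h : ∀ n : ℕ, a ≠ -(n : ℂ) / 2) (k : ℕ) :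
    pfsTerm (a + 1) k = pfsTerm a (k + 1) - unitTerm a (k + 1) / a ^ 2 := by
  have h0 := ne_zero_of_ne_neg_half h
  have h1 := add_natCast_ne_zero h (k + 1)
  have h2 := Complex.Gamma_ne_zero (ne_neg_natCast h)
  have h3 : (k.factorial : ℂ) ≠ 0 := Nat.cast_ne_zero.2 k.factorial_ne_zero
  have h4 : (k : ℂ) + 1 ≠ 0 := Nat.cast_add_one_ne_zero k
  have h5 : a + 1 + k = a + (k + 1 : ℕ) := by push_cast; ring
  unfold pfsTerm unitTerm
  rw [Gamma_two_mul_add_one_add h, Complex.Gamma_add_one _ h0, h5, Nat.factorial_succ, pow_succ]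
  push_cast at h1 ⊢
  field_simp
  ring

/-- The same factor appears; the extra part telescopes because `2 (a + n) = (2a + n) + n` with `n =
k + 1`. -/
theorem unitTerm_add_one {a : ℂ} (h : ∀ n : ℕ, a ≠ -(n : ℂ) / 2) (k : ℕ) :
    unitTerm (a + 1) k = unitTerm a (k + 1) + (boundaryTerm a k - boundaryTerm a (k + 1)) := by
  have h0 := ne_zero_of_ne_neg_half h
  have h1 := add_natCast_ne_zero h (k + 1)
  have h2 := Complex.Gamma_ne_zero (ne_neg_natCast h)
  have h3 : (k.factorial : ℂ) ≠ 0 := Nat.cast_ne_zero.2 k.factorial_ne_zero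
  have h4 : (k : ℂ) + 1 ≠ 0 := Nat.cast_add_one_ne_zero k
  have h5 : a + 1 + k = a + (k + 1 : ℕ) := by push_cast; ring
  have h6 : 2 * a + 1 + k = 2 * a + (k + 1 : ℕ) := by push_cast; ring
  have h7 : 2 * a + 1 + (k + 1 : ℕ) = 2 * (a + 1) + k := by push_cast; ring
  unfold unitTerm boundaryTerm
  rw [h7, h6, Gamma_two_mul_add_one_add h, Complex.Gamma_add_one _ h0, h5, Nat.factorial_succ,
    pow_succ]
  push_cast at h1 ⊢
  field_simp
  ring

theorem sum_pfsTerm_add_one {a : ℂ} (h : ∀ n : ℕ, a ≠ -(n : ℂ) / 2)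
    (N : ℕ) : ∑ k ∈ Finset.range N, pfsTerm (a + 1) k =
    ∑ k ∈ Finset.range (N + 1), pfsTerm a k -
      (∑ k ∈ Finset.range (N + 1), unitTerm a k) / a ^ 2 := by
  have h0 := ne_zero_of_ne_neg_half h
  -- The terms of index `0` cancel, so the sums on the right may start at `0`.
  have e : pfsTerm a 0 = unitTerm a 0 / a ^ 2 := by
    unfold pfsTerm unitTerm
    rw [Nat.cast_zero, add_zero, add_zero, div_div]
    congr 1
    ring
  rw [Finset.sum_congr rfl fun k _ => pfsTerm_add_one h k, Finset.sum_sub_distrib,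
    ← Finset.sum_div, Finset.sum_range_succ' _ N, Finset.sum_range_succ' _ N, e]
  ring

theorem sum_unitTerm_add_one {a : ℂ} (h : ∀ n : ℕ, a ≠ -(n : ℂ) / 2)
    (N : ℕ) : ∑ k ∈ Finset.range N, unitTerm (a + 1) k =
    ∑ k ∈ Finset.range (N + 1), unitTerm a k - boundaryTerm a N := by
  have h0 := ne_zero_of_ne_neg_half h
  have h2 := Complex.Gamma_ne_zero (ne_neg_natCast h)
  have e : unitTerm a 0 = boundaryTerm a 0 := by
    unfold unitTerm boundaryTerm
    rw [Nat.cast_zero, add_zero, add_zero, add_zero,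
      Complex.Gamma_add_one _ (mul_ne_zero two_ne_zero h0)]
    field_simp
  rw [Finset.sum_congr rfl fun k _ => unitTerm_add_one h k, Finset.sum_add_distrib,
    Finset.sum_range_sub', Finset.sum_range_succ' _ N, e]
  ring

/-- Up to a constant and a sign this is `pochCoeff (2 * a + 1) k`, of size `O(k^(2 Re a))`. -/
theorem tendsto_boundaryTerm {a : ℂ} (h : ∀ n : ℕ, a ≠ -(n : ℂ) / 2) (hre : a.re < 0) :
    Filter.Tendsto (boundaryTerm a) Filter.atTop (nhds 0) := by
  have hs : ∀ m : ℕ, 2 * a + 1 ≠ -m := fun m h' =>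
    two_mul_ne_neg_natCast h (m + 1) (by rw [eq_sub_of_add_eq h']; push_cast; ring)
  have h1 : Filter.Tendsto (fun k : ℕ => pochCoeff (2 * a + 1) k) Filter.atTop (nhds 0) := by
    refine (pochCoeff_isBigO hs).trans_tendsto ?_
    have hneg : 0 < -(2 * a.re) := by linarith
    refine ((tendsto_rpow_neg_atTop hneg).comp tendsto_natCast_atTop_atTop).congr fun k => ?_
    simp
  have h2 : Filter.Tendsto (fun k : ℕ => Complex.Gamma (2 * a + 1) / (a ^ 2 * Complex.Gamma a ^ 2) *
      pochCoeff (2 * a + 1) k) Filter.atTop (nhds 0) := by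
    simpa using h1.const_mul (Complex.Gamma (2 * a + 1) / (a ^ 2 * Complex.Gamma a ^ 2))
  rw [tendsto_zero_iff_norm_tendsto_zero] at h2 ⊢
  refine h2.congr fun k => ?_
  unfold boundaryTerm
  have h3 : (k.factorial : ℂ) ≠ 0 := Nat.cast_ne_zero.2 k.factorial_ne_zero
  rw [Gamma_add_natCast hs, norm_div, norm_mul ((-1 : ℂ) ^ k), norm_pow, norm_neg, norm_one,
    one_pow, one_mul, ← norm_div]
  congr 1
  have h0 := ne_zero_of_ne_neg_half h
  have h2 := Complex.Gamma_ne_zero (ne_neg_natCast h)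
  field_simp

theorem hurwitzZetaNat_two_eq_add (a : ℂ) :
    hurwitzZetaNat 2 a = 1 / a ^ 2 + hurwitzZetaNat 2 (a + 1) := by
  unfold hurwitzZetaNat
  rw [(summable_one_div_complex_add_nat_sq a).tsum_eq_zero_add, Nat.cast_zero, add_zero]
  congr 1
  refine tsum_congr fun k => ?_
  push_cast
  ring_nf

/-! ### Propagation to the half-planes `Re a < 1` and `Re a < 2` -/

theorem tendsto_sum_pfsTerm_of_mem_strip {a : ℂ} (h : ∀ n : ℕ, a ≠ -(n : ℂ) / 2)
    (h1 : -(7 / 8) < a.re) (h2 : a.re < 5 / 4) :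
    Filter.Tendsto (fun N : ℕ => ∑ k ∈ Finset.range N, pfsTerm a k) Filter.atTop
      (nhds (hurwitzZetaNat 2 a)) := by
  have h0 := ne_zero_of_ne_neg_half h
  have hΓ := Complex.Gamma_ne_zero (ne_neg_natCast h)
  have hΓ' := Complex.Gamma_ne_zero (two_mul_ne_neg_natCast h)
  have hs := (hasSum_alternating h1 h2 h0).mul_left
    (2 * Complex.Gamma (2 * a) / Complex.Gamma a ^ 2)
  rw [← mul_assoc, show 2 * Complex.Gamma (2 * a) / Complex.Gamma a ^ 2 *
    (Complex.Gamma a ^ 2 / (2 * Complex.Gamma (2 * a))) = 1 by field_simp, one_mul] at hs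
  refine hs.tendsto_sum_nat.congr fun N => Finset.sum_congr rfl fun k _ => ?_
  have h3 : (k.factorial : ℂ) ≠ 0 := Nat.cast_ne_zero.2 k.factorial_ne_zero
  have h4 := add_natCast_ne_zero h k
  unfold pfsTerm
  rw [Gamma_add_natCast (two_mul_ne_neg_natCast h)]
  field_simp

/-- Here `a` and `a + 1` both lie in the strip where the main formula is known. The range of real
parts has length `9/8 > 1`, enough for unit shifts to reach the rest. -/
theorem tendsto_sum_unitTerm_of_mem_strip {a : ℂ} (h : ∀ n : ℕ, a ≠ -(n : ℂ) / 2)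
    (h1 : -(7 / 8) < a.re) (h2 : a.re < 1 / 4) :
    Filter.Tendsto (fun N : ℕ => ∑ k ∈ Finset.range N, unitTerm a k) Filter.atTop (nhds 1) := by
  have h0 := ne_zero_of_ne_neg_half h
  rw [← Filter.tendsto_add_atTop_iff_nat 1]
  have hS := tendsto_sum_pfsTerm_of_mem_strip h h1 (by linarith)
  have hS' := tendsto_sum_pfsTerm_of_mem_strip (add_one_ne_neg_half h)
    (by rw [Complex.add_re, Complex.one_re]; linarith)
    (by rw [Complex.add_re, Complex.one_re]; linarith)
  have ht := (((Filter.tendsto_add_atTop_iff_nat 1).2 hS).sub hS').const_mul (a ^ 2)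
  rw [hurwitzZetaNat_two_eq_add a, add_sub_cancel_right, mul_one_div_cancel (pow_ne_zero 2 h0)]
    at ht
  refine ht.congr fun N => ?_
  rw [sum_pfsTerm_add_one h]
  field_simp
  ring

theorem tendsto_sum_unitTerm_add_one_iff {a : ℂ} (h : ∀ n : ℕ, a ≠ -(n : ℂ) / 2) (hre : a.re < 0) :
    Filter.Tendsto (fun N : ℕ => ∑ k ∈ Finset.range N, unitTerm (a + 1) k) Filter.atTop (nhds 1) ↔
    Filter.Tendsto (fun N : ℕ => ∑ k ∈ Finset.range N, unitTerm a k) Filter.atTop (nhds 1) := by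
  have hT := tendsto_boundaryTerm h hre
  rw [← Filter.tendsto_add_atTop_iff_nat (f := fun N : ℕ => ∑ k ∈ Finset.range N, unitTerm a k) 1]
  simp only [sum_unitTerm_add_one h]
  constructor
  · intro ht
    simpa using ht.add hT
  · intro ht
    simpa using ht.sub hT

/-- The shift cannot reach this point, since `a - 1 = -1/2` is excluded. The series is `4/π` times
Leibniz's series for `π/4`. -/
theorem tendsto_sum_unitTerm_one_half :
    Filter.Tendsto (fun N : ℕ => ∑ k ∈ Finset.range N, unitTerm (1 / 2) k) Filter.atTop
      (nhds 1) := by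
  have ht := ((Complex.continuous_ofReal.tendsto _).comp Real.tendsto_sum_pi_div_four).const_mul
    (4 / (Real.pi : ℂ))
  have hπ : (Real.pi : ℂ) ≠ 0 := Complex.ofReal_ne_zero.2 Real.pi_ne_zero
  rw [show 4 / (Real.pi : ℂ) * ((Real.pi / 4 : ℝ) : ℂ) = 1 by push_cast; field_simp] at ht
  refine ht.congr fun N => ?_
  simp only [Function.comp]
  push_cast
  rw [Finset.mul_sum]
  refine Finset.sum_congr rfl fun k _ => ?_
  have h3 : (k.factorial : ℂ) ≠ 0 := Nat.cast_ne_zero.2 k.factorial_ne_zero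
  have h4 : 2 * (k : ℂ) + 1 ≠ 0 := by exact_mod_cast (2 * k).succ_ne_zero
  have h5 : (1 / 2 : ℂ) + k = (2 * k + 1) / 2 := by ring
  have h6 : Complex.Gamma (1 / 2) ^ 2 = Real.pi := by
    rw [Complex.Gamma_one_half_eq, ← Complex.cpow_nat_mul]
    norm_num
  unfold unitTerm
  rw [show 2 * (1 / 2 : ℂ) + k = k + 1 by ring, Complex.Gamma_nat_eq_factorial, h6, h5]
  field_simp
  norm_num

theorem tendsto_sum_unitTerm {a : ℂ} (h : ∀ n : ℕ, a ≠ -(n : ℂ) / 2) (hre : a.re < 1) :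
    Filter.Tendsto (fun N : ℕ => ∑ k ∈ Finset.range N, unitTerm a k) Filter.atTop (nhds 1) := by
  rcases lt_or_ge a.re (1 / 4) with hlt | hge
  -- `n` bounds the number of upward shifts needed to enter the strip.
  · obtain ⟨n, hn⟩ := exists_nat_gt (-a.re)
    induction n generalizing a with
    | zero =>
      rw [Nat.cast_zero] at hn
      exact tendsto_sum_unitTerm_of_mem_strip h (by linarith) hlt
    | succ n ih =>
      rcases lt_or_ge (-(7 / 8)) a.re with h1 | h1
      · exact tendsto_sum_unitTerm_of_mem_strip h h1 hlt
      · have e : (a + 1).re = a.re + 1 := by rw [Complex.add_re, Complex.one_re]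
        push_cast at hn
        rw [← tendsto_sum_unitTerm_add_one_iff h (by linarith)]
        exact ih (add_one_ne_neg_half h) (by linarith) (by linarith) (by linarith)
  · by_cases hhalf : a = 1 / 2
    · rw [hhalf]
      exact tendsto_sum_unitTerm_one_half
    · obtain ⟨b, rfl⟩ : ∃ b, a = b + 1 := ⟨a - 1, (sub_add_cancel a 1).symm⟩
      rw [Complex.add_re, Complex.one_re] at hre hge
      have hb : ∀ n : ℕ, b ≠ -(n : ℂ) / 2 := by
        -- `b = 0` contradicts `Re a < 1`, `b = -1/2` is the case `a = 1/2`, and any other value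
        -- makes `a` itself excluded.
        rintro (_ | _ | n) hn
        · simp [hn] at hre
        · exact hhalf (by rw [hn]; push_cast; ring)
        · exact h n (by rw [hn]; push_cast; ring)
      rw [tendsto_sum_unitTerm_add_one_iff hb (by linarith)]
      exact tendsto_sum_unitTerm_of_mem_strip hb (by linarith) (by linarith)

theorem tendsto_sum_pfsTerm_add_one_iff {a : ℂ} (h : ∀ n : ℕ, a ≠ -(n : ℂ) / 2) (hre : a.re < 1) :
    Filter.Tendsto (fun N : ℕ => ∑ k ∈ Finset.range N, pfsTerm (a + 1) k) Filter.atTop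
      (nhds (hurwitzZetaNat 2 (a + 1))) ↔
    Filter.Tendsto (fun N : ℕ => ∑ k ∈ Finset.range N, pfsTerm a k) Filter.atTop
      (nhds (hurwitzZetaNat 2 a)) := by
  have hU := ((Filter.tendsto_add_atTop_iff_nat 1).2 (tendsto_sum_unitTerm h hre)).div_const (a ^ 2)
  rw [← Filter.tendsto_add_atTop_iff_nat (f := fun N : ℕ => ∑ k ∈ Finset.range N, pfsTerm a k) 1,
    hurwitzZetaNat_two_eq_add a]
  simp only [sum_pfsTerm_add_one h]
  constructor
  · intro ht
    simpa [add_comm] using ht.add hU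
  · intro ht
    simpa using ht.sub hU

theorem tendsto_sum_pfsTerm {a : ℂ} (h : ∀ n : ℕ, a ≠ -(n : ℂ) / 2) (hre : a.re < 2) :
    Filter.Tendsto (fun N : ℕ => ∑ k ∈ Finset.range N, pfsTerm a k) Filter.atTop
      (nhds (hurwitzZetaNat 2 a)) := by
  rcases lt_or_ge a.re (5 / 4) with hlt | hge
  · obtain ⟨n, hn⟩ := exists_nat_gt (-a.re)
    induction n generalizing a with
    | zero =>
      rw [Nat.cast_zero] at hn
      exact tendsto_sum_pfsTerm_of_mem_strip h (by linarith) hlt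
    | succ n ih =>
      rcases lt_or_ge (-(7 / 8)) a.re with h1 | h1
      · exact tendsto_sum_pfsTerm_of_mem_strip h h1 hlt
      · have e : (a + 1).re = a.re + 1 := by rw [Complex.add_re, Complex.one_re]
        push_cast at hn
        rw [← tendsto_sum_pfsTerm_add_one_iff h (by linarith)]
        exact ih (add_one_ne_neg_half h) (by linarith) (by linarith) (by linarith)
  · obtain ⟨b, rfl⟩ : ∃ b, a = b + 1 := ⟨a - 1, (sub_add_cancel a 1).symm⟩
    rw [Complex.add_re, Complex.one_re] at hre hge
    have hb : ∀ n : ℕ, b ≠ -(n : ℂ) / 2 := by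
      intro n hn
      have h0 : b.re = -(n : ℝ) / 2 := by
        rw [hn, show -(n : ℂ) / 2 = ((-(n : ℝ) / 2 : ℝ) : ℂ) by push_cast; rfl, Complex.ofReal_re]
      have : (0 : ℝ) ≤ n := Nat.cast_nonneg n
      linarith
    rw [tendsto_sum_pfsTerm_add_one_iff hb (by linarith)]
    exact tendsto_sum_pfsTerm_of_mem_strip hb (by linarith) (by linarith)

theorem mainTheorem5 (a : ℂ) (ha : a.re < 2) (ha' : ∀ n : ℕ, a ≠ -(n : ℂ) / 2) :
    HasSum (fun k : ℕ => 1 / (a + (k : ℂ)) ^ 2) (hurwitzZetaNat 2 a) ∧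
    Filter.Tendsto
      (fun N : ℕ => ∑ k ∈ Finset.range N,
        2 * (-1 : ℂ) ^ k * Complex.Gamma (2 * a + k) /
          (Complex.Gamma a ^ 2 * (Nat.factorial k : ℂ) * (a + (k : ℂ)) ^ 3))
      Filter.atTop (nhds (hurwitzZetaNat 2 a)) :=
  ⟨(summable_one_div_complex_add_nat_sq a).hasSum, tendsto_sum_pfsTerm ha' ha⟩
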